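/- Let $n\ge 1$ and let $K\subset\mathbb R^n$ be a compact convex body (with non-empty interior) with smooth boundary, i.e. with a unique support hyperplane at each boundary point. Let $L\subset\mathbb R^n$ be a lattice of full rank, with determinant (covolume) $\det(L)$ and minimal norm $\|L\|=\min\{\|x\|:x\in L\setminus\{0\}\}$, and let $D(K)$ be the Euclidean diameter of $K$. A set $S$ *illuminates* $K$ if for every $y\in\partial K$ there is $x\in S$ such that the segment from $x$ to $y$ does not meet $\operatorname{int}(K)$ but the line through $x$ and $y$ does; the illumination distance is $d(S,K)=\max\{\|x-y\|:x\in S,\ y\in K\}$. A basis $a_1,\dots,a_n$ of $L$ with Gram–Schmidt orthogonalization $a_1^*,\dots,a_n^*$ is *HKZ-reduced* if $|\langle a_i,a_j^*\rangle|\le\frac12\|a_j^*\|^2$ for all $j<i$ and, for each $i$, $a_i^*$ is a shortest nonzero vector of the orthogonal projection of $L$ onto $\operatorname{span}(a_1,\dots,a_{i-1})^\perp$. Then there are an HKZ-reduced basis $a_1,\dots,a_n$ of $L$, an integer $t\ge1$ and a translate $K'$ of $K$ such that the set $S=\{0,ta_1,\dots,ta_n\}\subset L$ has exactly $n+1$ elements,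 the simplex with vertex set $S$ contains $K'$ in its interior, $S$ illuminates $K'$, and, with $[\,\cdot\,]$ denoting the integer part, $$d(S,K')\le 2\left[\,n\left(n+2^{n-1}\right)\sqrt{\tfrac{n}{2(n+1)}}\left(\tfrac43\right)^{\frac{n(n-1)}2}\frac{D(K)}{\|L\|}+1\right]\left(\tfrac43\right)^{\frac{n(n-1)}2}\frac{\det(L)}{\|L\|^{n-1}} .$$ If moreover $$\|L\|\le n\left(n+2^{n-1}\right)\left(\sqrt2-\sqrt{\tfrac{n}{2(n+1)}}\right)\left(\tfrac43\right)^{\frac{n(n-1)}2}D(K)$$ (which holds, for example, whenever $D(K)\ge\|L\|$), then for the same $S$ and $K'$ $$d(S,K')\le 2\sqrt2\,n\left(n+2^{n-1}\right)\left(\tfrac43\right)^{n(n-1)}D(K)\,\frac{\det(L)}{\|L\|^n}.$$ -/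

import Mathlib

open scoped Pointwise

noncomputable section

/-- The hyperplane `H` supports the set `K` at the point `y`: it passes through `y` and `K` lies in
one of the two closed half-spaces bounded by it. -/
def IsSupportHyperplane {n : ℕ} (K : Set (EuclideanSpace ℝ (Fin n)))
    (y : EuclideanSpace ℝ (Fin n)) (H : Set (EuclideanSpace ℝ (Fin n))) : Prop :=
  ∃ u : EuclideanSpace ℝ (Fin n), u ≠ 0 ∧
    H = {x | inner ℝ u x = inner ℝ u y} ∧ ∀ x ∈ K, inner ℝ u x ≤ inner ℝ u y

/-- Compact convex bodies (with non-empty interior) in `ℝⁿ` with smooth boundary, that is, with a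
unique support hyperplane at each boundary point. -/
structure IsSmoothConvexBody {n : ℕ} (K : Set (EuclideanSpace ℝ (Fin n))) : Prop where
  convex : Convex ℝ K
  isCompact : IsCompact K
  interior_nonempty : (interior K).Nonempty
  smooth : ∀ y ∈ frontier K, ∃! H : Set (EuclideanSpace ℝ (Fin n)), IsSupportHyperplane K y H

/-- The point `x` illuminates the (boundary) point `y` of `K`: the segment from `x` to `y` misses
the interior of `K`, but the line through `x` and `y` meets it. (For `x = y` the "line" is the
single point `y`, so a boundary point does not illuminate itself.) -/
def IlluminatesPoint {n : ℕ} (K : Set (EuclideanSpace ℝ (Fin n)))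
    (x y : EuclideanSpace ℝ (Fin n)) : Prop :=
  Disjoint (segment ℝ x y) (interior K) ∧
    ((line[ℝ, x, y] : Set (EuclideanSpace ℝ (Fin n))) ∩ interior K).Nonempty

/-- The set `S` illuminates `K`: every boundary point of `K` is illuminated by a point of `S`. -/
def Illuminates {n : ℕ} (S K : Set (EuclideanSpace ℝ (Fin n))) : Prop :=
  ∀ y ∈ frontier K, ∃ x ∈ S, IlluminatesPoint K x y

/-- The illumination distance `d(S, K)`, the largest distance from a point of `S` to a point of `K`
(the supremum is attained for `S` finite and `K` compact, both non-empty). -/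
def illuminationDist {n : ℕ} (S K : Set (EuclideanSpace ℝ (Fin n))) : ℝ :=
  sSup {r | ∃ x ∈ S, ∃ y ∈ K, r = dist x y}

/-- The minimal norm `‖L‖` of a lattice, the least norm of a nonzero vector of `L`
(attained when `L` is a nonzero lattice). -/
def latticeMinNorm {n : ℕ} (L : Submodule ℤ (EuclideanSpace ℝ (Fin n))) : ℝ :=
  sInf {r | ∃ x ∈ L, x ≠ 0 ∧ r = ‖x‖}

/-- Hermite-Korkin-Zolotarev reduced bases `a` of a lattice `L`. Write `a*` for the Gram-Schmidt
orthogonalization of `a`. The Gram-Schmidt coefficients are at most `1/2` in absolute value, and,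
for each `i`, the vector `a*ᵢ` is a shortest nonzero vector of the orthogonal projection of `L` onto
the orthogonal complement of the span of the `aⱼ` with `j < i`. -/
structure IsHKZReduced {n : ℕ} {L : Submodule ℤ (EuclideanSpace ℝ (Fin n))}
    (a : Module.Basis (Fin n) ℤ L) : Prop where
  size_reduced : ∀ i j : Fin n, j < i →
    |inner ℝ (a i : EuclideanSpace ℝ (Fin n))
        (InnerProductSpace.gramSchmidt ℝ (fun k => (a k : EuclideanSpace ℝ (Fin n))) j) /
      ‖InnerProductSpace.gramSchmidt ℝ (fun k => (a k : EuclideanSpace ℝ (Fin n))) j‖ ^ 2| ≤ 1 / 2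
  shortest : ∀ i : Fin n, ∀ x ∈ L,
    (Submodule.span ℝ ((fun k => (a k : EuclideanSpace ℝ (Fin n))) '' Set.Iio i))ᗮ.starProjection x
        ≠ 0 →
    ‖InnerProductSpace.gramSchmidt ℝ (fun k => (a k : EuclideanSpace ℝ (Fin n))) i‖ ≤
      ‖(Submodule.span ℝ
        ((fun k => (a k : EuclideanSpace ℝ (Fin n))) '' Set.Iio i))ᗮ.starProjection x‖

end

/-! ### Gram–Schmidt for sequences, and existence of HKZ-reduced systems. -/

section HKZ

variable {E : Type*} [NormedAddCommGroup E] [InnerProductSpace ℝ E] [FiniteDimensional ℝ E]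

/-! Smoothness turns containment into illumination (`IsSmoothConvexBody.illuminates`): if `K'` lies
in the interior of `conv S`, some vertex is strictly beyond the support hyperplane at a given
boundary point `y`. A line through that vertex and `y` missing `int K'` would lie in a second
support hyperplane at `y`.

It remains to fit `K` into a lattice simplex. The simplex on `0` and the `t • aᵢ` is cut out by the
dual basis `b`, and the width of `K` along `bᵢ` is at most `D(K) * ‖bᵢ‖`, so a translate fits once
`t > D(K) * ∑ ‖bᵢ‖` (`exists_vadd_subset_interior_convexHull`). The simplex lies in the ball of
radius `t * max ‖aᵢ‖` about `0`, so distances are at most twice that.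

HKZ reduction controls both `‖bᵢ‖` (`IsHKZSystem.norm_dual_mul_le`) and `‖aᵢ‖`
(`IsHKZSystem.norm_mul_pow_le`). Reduced systems are built one vector at a time as prefixes of
sequences on `ℕ`, indexed from `0`, so that `‖f 0‖ = ‖L‖`; they become `Fin n`-indexed bases only at
the end. -/

/-- The orthogonal projection along the span of the first `k` terms of the sequence `f`. -/
noncomputable def projPerp (f : ℕ → E) (k : ℕ) : E →L[ℝ] E :=
  (Submodule.span ℝ (f '' Set.Iio k))ᗮ.starProjection

/-- The Gram-Schmidt orthogonalization of a sequence, in terms of orthogonal projections. -/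
noncomputable def gsVec (f : ℕ → E) (k : ℕ) : E := projPerp f k (f k)

theorem projPerp_congr {f g : ℕ → E} {k : ℕ} (h : ∀ i < k, f i = g i) :
    projPerp f k = projPerp g k := by
  have hfg : f '' Set.Iio k = g '' Set.Iio k := Set.image_congr fun i hi => h i hi
  simp only [projPerp, hfg]

theorem gsVec_congr {f g : ℕ → E} {k : ℕ} (h : ∀ i ≤ k, f i = g i) :
    gsVec f k = gsVec g k := by
  unfold gsVec
  rw [projPerp_congr fun i hi => h i hi.le, h k le_rfl]

theorem projPerp_eq_zero_iff (f : ℕ → E) (k : ℕ) (x : E) :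
    projPerp f k x = 0 ↔ x ∈ Submodule.span ℝ (f '' Set.Iio k) := by
  rw [projPerp, Submodule.starProjection_apply_eq_zero_iff, Submodule.orthogonal_orthogonal]

theorem projPerp_zero (f : ℕ → E) (x : E) : projPerp f 0 x = x := by
  rw [projPerp, Submodule.starProjection_eq_self_iff]
  simp

theorem sub_projPerp_mem (f : ℕ → E) (k : ℕ) (x : E) :
    x - projPerp f k x ∈ Submodule.span ℝ (f '' Set.Iio k) := by
  rw [← projPerp_eq_zero_iff, map_sub, sub_eq_zero]
  refine (Submodule.starProjection_eq_self_iff.2 ?_).symm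
  simp [projPerp]

theorem projPerp_mem (f : ℕ → E) (k : ℕ) (x : E) :
    projPerp f k x ∈ (Submodule.span ℝ (f '' Set.Iio k))ᗮ := by
  simp [projPerp]

theorem inner_projPerp_comm (f : ℕ → E) (k : ℕ) (x y : E) :
    inner ℝ x (projPerp f k y) = inner ℝ (projPerp f k x) (projPerp f k y) := by
  have h := (Submodule.mem_orthogonal _ _).1 (projPerp_mem f k y) _ (sub_projPerp_mem f k x)
  rw [inner_sub_left] at h
  linarith

theorem inner_gsVec_of_mem_span {f : ℕ → E} {k : ℕ} {x : E}
    (hx : x ∈ Submodule.span ℝ (f '' Set.Iio k)) : inner ℝ x (gsVec f k) = 0 :=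
  (Submodule.mem_orthogonal _ _).1 (projPerp_mem f k (f k)) _ hx

theorem inner_self_gsVec (f : ℕ → E) (k : ℕ) :
    inner ℝ (f k) (gsVec f k) = ‖gsVec f k‖ ^ 2 := by
  rw [gsVec, inner_projPerp_comm, real_inner_self_eq_norm_sq]

/-- The Gram-Schmidt coefficient of `x` along the `k`-th orthogonalized vector. -/
noncomputable def gsCoeff (f : ℕ → E) (k : ℕ) (x : E) : ℝ :=
  inner ℝ x (gsVec f k) / ‖gsVec f k‖ ^ 2

/-- No nonvanishing is needed: if `gsVec f k = 0`, both sides are `0`. -/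
theorem gsCoeff_mul (f : ℕ → E) (k : ℕ) (x : E) :
    gsCoeff f k x * ‖gsVec f k‖ ^ 2 = inner ℝ x (gsVec f k) := by
  unfold gsCoeff
  by_cases h : gsVec f k = 0
  · simp [h]
  · have : ‖gsVec f k‖ ≠ 0 := by simpa using h
    field_simp

theorem gsCoeff_sub (f : ℕ → E) (k : ℕ) (x y : E) :
    gsCoeff f k (x - y) = gsCoeff f k x - gsCoeff f k y := by
  simp [gsCoeff, inner_sub_left, sub_div]

theorem gsCoeff_zsmul (f : ℕ → E) (k : ℕ) (m : ℤ) (x : E) :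
    gsCoeff f k (m • x) = m * gsCoeff f k x := by
  rw [← Int.cast_smul_eq_zsmul ℝ]
  simp [gsCoeff, real_inner_smul_left, mul_div_assoc]

theorem gsCoeff_of_mem_span {f : ℕ → E} {k : ℕ} {x : E}
    (hx : x ∈ Submodule.span ℝ (f '' Set.Iio k)) : gsCoeff f k x = 0 := by
  simp [gsCoeff, inner_gsVec_of_mem_span hx]

theorem gsCoeff_self {f : ℕ → E} {k : ℕ} (h : gsVec f k ≠ 0) : gsCoeff f k (f k) = 1 := by
  have : ‖gsVec f k‖ ≠ 0 := by simpa using h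
  rw [gsCoeff, inner_self_gsVec]
  field_simp

theorem Iio_add_one_eq_insert (k : ℕ) : Set.Iio (k + 1) = insert k (Set.Iio k) := by
  ext i
  simp only [Set.mem_Iio, Set.mem_insert_iff]
  omega

theorem projPerp_succ (f : ℕ → E) (k : ℕ) (x : E) :
    projPerp f k x = projPerp f (k + 1) x + gsCoeff f k x • gsVec f k := by
  rw [eq_comm, ← eq_sub_iff_add_eq]
  refine Submodule.eq_starProjection_of_mem_orthogonal ?_ ?_
  · rw [Iio_add_one_eq_insert, Set.image_insert_eq]
    rw [Submodule.mem_orthogonal]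
    intro u hu
    obtain ⟨c, z, hz, rfl⟩ := Submodule.mem_span_insert.1 hu
    have h1 := (Submodule.mem_orthogonal _ _).1 (projPerp_mem f k x) _ hz
    have h2 := inner_gsVec_of_mem_span hz
    have h3 : inner ℝ (f k) (projPerp f k x) = inner ℝ x (gsVec f k) := by
      rw [inner_projPerp_comm, gsVec, inner_projPerp_comm f k x, real_inner_comm]
    simp only [inner_add_left, inner_sub_right, real_inner_smul_left, real_inner_smul_right,
      h1, h2, h3, inner_self_gsVec]
    linear_combination c * -gsCoeff_mul f k x
  · rw [Submodule.orthogonal_orthogonal]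
    have hle : Submodule.span ℝ (f '' Set.Iio k) ≤ Submodule.span ℝ (f '' Set.Iio (k + 1)) :=
      Submodule.span_mono (Set.image_mono (Set.Iio_subset_Iio (by omega)))
    have h1 := hle (sub_projPerp_mem f k x)
    have h2 := hle (sub_projPerp_mem f k (f k))
    have h3 : f k ∈ Submodule.span ℝ (f '' Set.Iio (k + 1)) :=
      Submodule.subset_span ⟨k, by simp, rfl⟩
    have h4 : gsVec f k ∈ Submodule.span ℝ (f '' Set.Iio (k + 1)) := by
      have := Submodule.sub_mem _ h3 h2
      rwa [sub_sub_cancel] at this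
    have := Submodule.add_mem _ h1 (Submodule.smul_mem _ (gsCoeff f k x) h4)
    convert this using 1
    abel

theorem norm_projPerp_sq_succ (f : ℕ → E) (k : ℕ) (x : E) :
    ‖projPerp f k x‖ ^ 2 = ‖projPerp f (k + 1) x‖ ^ 2 + gsCoeff f k x ^ 2 * ‖gsVec f k‖ ^ 2 := by
  have h0 : inner ℝ (projPerp f (k + 1) x) (gsVec f k) = 0 := by
    rw [real_inner_comm]
    refine (Submodule.mem_orthogonal _ _).1 (projPerp_mem f (k + 1) x) _ ?_
    have h3 : f k ∈ Submodule.span ℝ (f '' Set.Iio (k + 1)) :=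
      Submodule.subset_span ⟨k, by simp, rfl⟩
    have := Submodule.sub_mem _ h3 (Submodule.span_mono
      (Set.image_mono (Set.Iio_subset_Iio (by omega))) (sub_projPerp_mem f k (f k)))
    rwa [sub_sub_cancel] at this
  rw [projPerp_succ f k x, norm_add_sq_real, real_inner_smul_right, h0, norm_smul, mul_pow]
  simp

theorem norm_projPerp_sq_eq_add_sum (f : ℕ → E) (x : E) {m k : ℕ} (hmk : m ≤ k) :
    ‖projPerp f m x‖ ^ 2 = ‖projPerp f k x‖ ^ 2 +
      ∑ j ∈ Finset.Ico m k, gsCoeff f j x ^ 2 * ‖gsVec f j‖ ^ 2 := by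
  induction k, hmk using Nat.le_induction with
  | base => simp
  | succ k hk ih => rw [ih, norm_projPerp_sq_succ, Finset.sum_Ico_succ_top hk]; ring

theorem eq_projPerp_add_sum (f : ℕ → E) (x : E) (k : ℕ) :
    x = projPerp f k x + ∑ j ∈ Finset.range k, gsCoeff f j x • gsVec f j := by
  induction k with
  | zero => simp [projPerp_zero]
  | succ k ih =>
    rw [projPerp_succ] at ih
    rw [Finset.sum_range_succ, add_comm (Finset.sum _ _), ← add_assoc]
    exact ih

theorem zspan_le_span {V : Type*} [AddCommGroup V] [Module ℝ V] {f : ℕ → V} {s : Set ℕ} {z : V}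
    (hz : z ∈ Submodule.span ℤ (f '' s)) :
    z ∈ Submodule.span ℝ (f '' s) :=
  Submodule.span_subset_span ℤ ℝ _ hz

/-- Every vector can be size-reduced by an integer combination of the first `k` vectors. -/
theorem exists_size_reduced (f : ℕ → E) (k : ℕ) (x : E) :
    ∃ z ∈ Submodule.span ℤ (f '' Set.Iio k), ∀ j < k, |gsCoeff f j (x - z)| ≤ 1 / 2 := by
  induction k generalizing x with
  | zero => exact ⟨0, zero_mem _, by simp⟩
  | succ k ih =>
    -- The top coefficient is rounded off first; the later corrections lie in the span of the first
    -- `k` vectors and do not affect it.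
    obtain ⟨z, hz, h⟩ := ih (x - round (gsCoeff f k x) • f k)
    refine ⟨round (gsCoeff f k x) • f k + z, ?_, fun j hj => ?_⟩
    · refine add_mem (Submodule.smul_mem _ _ (Submodule.subset_span ⟨k, by simp, rfl⟩)) ?_
      exact Submodule.span_mono (Set.image_mono (Set.Iio_subset_Iio (by omega))) hz
    · rw [← sub_sub]
      rcases Nat.lt_succ_iff_lt_or_eq.1 hj with hj | rfl
      · exact h j hj
      · rw [gsCoeff_sub, gsCoeff_of_mem_span (zspan_le_span hz), sub_zero, gsCoeff_sub,
          gsCoeff_zsmul]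
        by_cases h0 : gsVec f j = 0
        · simp [gsCoeff, h0]
        · rw [gsCoeff_self h0, mul_one]
          exact abs_sub_round _

/-- The first `k` terms of `f` form an HKZ-reduced system of vectors of `L` that generates the
intersection of `L` with its real span. -/
structure IsHKZSystem (L : Submodule ℤ E) (f : ℕ → E) (k : ℕ) : Prop where
  mem : ∀ i < k, f i ∈ L
  gsVec_ne_zero : ∀ i < k, gsVec f i ≠ 0
  size_reduced : ∀ i < k, ∀ j < i, |gsCoeff f j (f i)| ≤ 1 / 2
  shortest : ∀ i < k, ∀ x ∈ L, projPerp f i x ≠ 0 → ‖gsVec f i‖ ≤ ‖projPerp f i x‖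
  primitive : ∀ x ∈ L, x ∈ Submodule.span ℝ (f '' Set.Iio k) → x ∈ Submodule.span ℤ (f '' Set.Iio k)

theorem exists_shortest_projPerp (L : Submodule ℤ E) [DiscreteTopology L] {f : ℕ → E} {k : ℕ}
    (hf : ∀ i < k, f i ∈ L) (hne : ∃ x ∈ L, projPerp f k x ≠ 0) :
    ∃ x ∈ L, projPerp f k x ≠ 0 ∧ (∀ j < k, |gsCoeff f j x| ≤ 1 / 2) ∧
      ∀ y ∈ L, projPerp f k y ≠ 0 → ‖projPerp f k x‖ ≤ ‖projPerp f k y‖ := by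
  -- Size reduction leaves the projection unchanged, so the minimum may be sought among size-reduced
  -- vectors.
  have hred : ∀ x ∈ L, ∃ y ∈ L, projPerp f k y = projPerp f k x ∧
      ∀ j < k, |gsCoeff f j y| ≤ 1 / 2 := by
    intro x hx
    obtain ⟨z, hz, h⟩ := exists_size_reduced f k x
    have hzL : z ∈ L := by
      refine Submodule.span_le.2 ?_ hz
      rintro _ ⟨i, hi, rfl⟩
      exact hf i hi
    refine ⟨x - z, sub_mem hx hzL, ?_, h⟩
    rw [map_sub, (projPerp_eq_zero_iff f k z).2 (zspan_le_span hz), sub_zero]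
  obtain ⟨x₀, hx₀, hx₀'⟩ := hne
  obtain ⟨x₁, hx₁, hx₁e, hx₁r⟩ := hred x₀ hx₀
  -- `R` bounds the squared norm of every size-reduced vector whose projection is no longer than
  -- that of `x₀`; a discrete lattice has finitely many such vectors.
  set R := ‖projPerp f k x₀‖ ^ 2 + ∑ j ∈ Finset.Ico 0 k, (1 / 2) ^ 2 * ‖gsVec f j‖ ^ 2 with hR
  set T : Set E := {x | x ∈ L ∧ projPerp f k x ≠ 0 ∧ (∀ j < k, |gsCoeff f j x| ≤ 1 / 2) ∧
    ‖projPerp f k x‖ ≤ ‖projPerp f k x₀‖} with hT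
  have hTfin : T.Finite := by
    have hfin : (Metric.closedBall (0 : E) (√R) ∩ L).Finite :=
      Metric.finite_isBounded_inter_isClosed DiscreteTopology.isDiscrete
        Metric.isBounded_closedBall (inferInstanceAs (IsClosed (L.toAddSubgroup : Set E)))
    refine hfin.subset fun x hx => ⟨?_, hx.1⟩
    rw [mem_closedBall_zero_iff]
    refine Real.le_sqrt_of_sq_le ?_
    have h := norm_projPerp_sq_eq_add_sum f x (Nat.zero_le k)
    rw [projPerp_zero] at h
    rw [h, hR]
    have hx4 := hx.2.2.2
    refine add_le_add (pow_le_pow_left₀ (norm_nonneg _) hx4 2)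
      (Finset.sum_le_sum fun j hj => mul_le_mul_of_nonneg_right ?_ (sq_nonneg _))
    rw [← sq_abs]
    exact pow_le_pow_left₀ (abs_nonneg _) (hx.2.2.1 j (Finset.mem_Ico.1 hj).2) 2
  have hTne : T.Nonempty := ⟨x₁, hx₁, by rwa [hx₁e], hx₁r, by rw [hx₁e]⟩
  obtain ⟨x, hx, hmin⟩ := Set.exists_min_image T (fun x => ‖projPerp f k x‖) hTfin hTne
  refine ⟨x, hx.1, hx.2.1, hx.2.2.1, fun y hy hy0 => ?_⟩
  obtain ⟨y', hy', hye, hyr⟩ := hred y hy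
  rw [← hye] at hy0 ⊢
  rcases le_total ‖projPerp f k y'‖ ‖projPerp f k x₀‖ with h | h
  · exact hmin y' ⟨hy', hy0, hyr, h⟩
  · exact hx.2.2.2.trans h

/-- The new vector is a size-reduced one with shortest nonzero projection; this minimality is also
what preserves primitivity. -/
theorem IsHKZSystem.exists_succ {L : Submodule ℤ E} [DiscreteTopology L] {f : ℕ → E} {k : ℕ}
    (hf : IsHKZSystem L f k) (hne : ∃ x ∈ L, projPerp f k x ≠ 0) :
    ∃ g, IsHKZSystem L g (k + 1) := by
  obtain ⟨x, hxL, hx0, hxr, hmin⟩ := exists_shortest_projPerp L hf.mem hne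
  set g := Function.update f k x with hg
  have hgf : ∀ i < k, g i = f i := fun i hi => by simp [hg, hi.ne]
  have hgk : g k = x := by simp [hg]
  have hP : ∀ i ≤ k, projPerp g i = projPerp f i := fun i hi =>
    projPerp_congr fun j hj => hgf j (hj.trans_le hi)
  have hG : ∀ i < k, gsVec g i = gsVec f i := fun i hi =>
    gsVec_congr fun j hj => hgf j (hj.trans_lt hi)
  have hGk : gsVec g k = projPerp f k x := by rw [gsVec, hP k le_rfl, hgk]
  have himg : g '' Set.Iio k = f '' Set.Iio k := Set.image_congr fun i hi => hgf i hi
  refine ⟨g, fun i hi => ?_, fun i hi => ?_, fun i hi j hj => ?_, fun i hi y hy hy0 => ?_,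
    fun y hy hys => ?_⟩
  · rcases Nat.lt_succ_iff_lt_or_eq.1 hi with hi | rfl
    · rw [hgf i hi]; exact hf.mem i hi
    · rwa [hgk]
  · rcases Nat.lt_succ_iff_lt_or_eq.1 hi with hi | rfl
    · rw [hG i hi]; exact hf.gsVec_ne_zero i hi
    · rwa [hGk]
  · have hjk : j < k := by omega
    rw [gsCoeff, hG j hjk, ← gsCoeff]
    rcases Nat.lt_succ_iff_lt_or_eq.1 hi with hi | rfl
    · rw [hgf i hi]; exact hf.size_reduced i hi j hj
    · rw [hgk]; exact hxr j hj
  · rw [hP i (by omega)] at hy0 ⊢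
    rcases Nat.lt_succ_iff_lt_or_eq.1 hi with hi | rfl
    · rw [hG i hi]; exact hf.shortest i hi y hy hy0
    · rw [hGk]; exact hmin y hy hy0
  · have hk : gsVec g k ≠ 0 := by rwa [hGk]
    set m := round (gsCoeff g k y) with hm
    have hzL : y - m • x ∈ L := sub_mem hy (L.smul_mem m hxL)
    have hPz : projPerp f k (y - m • x) = (gsCoeff g k y - m) • gsVec g k := by
      have h1 := projPerp_succ g k y
      rw [(projPerp_eq_zero_iff g (k + 1) y).2 hys, zero_add, hP k le_rfl] at h1
      rw [map_sub, h1, ← Int.cast_smul_eq_zsmul ℝ, map_smul, ← hGk, sub_smul]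
    -- After rounding, the projection is at most half as long as the shortest nonzero one, so it
    -- vanishes and the primitivity of the shorter system applies.
    have hz0 : projPerp f k (y - m • x) = 0 := by
      by_contra h0
      have h1 := hmin _ hzL h0
      rw [hPz, norm_smul, ← hGk] at h1
      have h2 : |gsCoeff g k y - m| ≤ 1 / 2 := abs_sub_round _
      have h3 : 0 < ‖gsVec g k‖ := norm_pos_iff.2 hk
      rw [Real.norm_eq_abs] at h1
      nlinarith
    have hmem := hf.primitive _ hzL ((projPerp_eq_zero_iff f k _).1 hz0)
    rw [Iio_add_one_eq_insert, Set.image_insert_eq, himg, hgk, Submodule.mem_span_insert]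
    exact ⟨m, _, hmem, by abel⟩

theorem finrank_span_image_Iio_le {V : Type*} [AddCommGroup V] [Module ℝ V] (f : ℕ → V) (k : ℕ) :
    Module.finrank ℝ (Submodule.span ℝ (f '' Set.Iio k)) ≤ k := by
  classical
  have h := finrank_span_finset_le_card (R := ℝ) ((Finset.range k).image f)
  rw [Finset.coe_image, Finset.coe_range] at h
  exact h.trans (Finset.card_image_le.trans (by simp))

/-- While `k` is below the dimension, `k` vectors cannot span the full-rank lattice, so some lattice
vector has nonzero projection. -/
theorem exists_isHKZSystem (L : Submodule ℤ E) [DiscreteTopology L] [IsZLattice ℝ L] {k : ℕ}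
    (hk : k ≤ Module.finrank ℝ E) : ∃ f, IsHKZSystem L f k := by
  induction k with
  | zero =>
    refine ⟨0, by simp, by simp, by simp, by simp, fun x _ hx => ?_⟩
    have : x = 0 := by simpa using hx
    simp [this]
  | succ k ih =>
    obtain ⟨f, hf⟩ := ih (by omega)
    refine hf.exists_succ ?_
    by_contra! h
    have h1 : Submodule.span ℝ (L : Set E) ≤ Submodule.span ℝ (f '' Set.Iio k) :=
      Submodule.span_le.2 fun x hx => (projPerp_eq_zero_iff f k x).1 (h x hx)
    rw [IsZLattice.span_top, top_le_iff] at h1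
    have h2 := finrank_span_image_Iio_le f k
    rw [h1, finrank_top] at h2
    omega

theorem IsHKZSystem.linearIndepOn {L : Submodule ℤ E} {f : ℕ → E} {k : ℕ}
    (hf : IsHKZSystem L f k) : LinearIndepOn ℝ f (Set.Iio k) := by
  have h0 := hf.gsVec_ne_zero
  clear hf
  induction k with
  | zero => simp
  | succ k ih =>
    rw [Iio_add_one_eq_insert, linearIndepOn_insert (by simp)]
    refine ⟨ih fun i hi => h0 i (by omega), fun hk => h0 k (by omega) ?_⟩
    exact (projPerp_eq_zero_iff f k _).2 hk

end HKZ

/-! ### Norm bounds for reduced vectors and their dual basis. -/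

section Estimates

variable {E : Type*} [NormedAddCommGroup E] [InnerProductSpace ℝ E] [FiniteDimensional ℝ E]
  {L : Submodule ℤ E} {f : ℕ → E} {n : ℕ}

theorem IsHKZSystem.norm_gsVec_pos (hf : IsHKZSystem L f n) {i : ℕ} (hi : i < n) :
    0 < ‖gsVec f i‖ :=
  norm_pos_iff.2 (hf.gsVec_ne_zero i hi)

theorem IsHKZSystem.gsCoeff_sq_le (hf : IsHKZSystem L f n) {i j : ℕ} (hi : i < n) (hj : j < i) :
    gsCoeff f j (f i) ^ 2 ≤ 1 / 4 := by
  have := abs_le.1 (hf.size_reduced i hi j hj)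
  nlinarith

/-- By minimality and Pythagoras, `‖a*ᵢ‖² ≤ ‖a*ᵢ₊₁‖² + ‖a*ᵢ‖² / 4`. -/
theorem IsHKZSystem.norm_gsVec_sq_le_succ (hf : IsHKZSystem L f n) {i : ℕ} (hi : i + 1 < n) :
    ‖gsVec f i‖ ^ 2 ≤ 4 / 3 * ‖gsVec f (i + 1)‖ ^ 2 := by
  have h0 : projPerp f i (f (i + 1)) ≠ 0 := fun h => by
    refine hf.gsVec_ne_zero _ hi ((projPerp_eq_zero_iff f (i + 1) _).2 ?_)
    exact Submodule.span_mono (Set.image_mono (Set.Iio_subset_Iio (by omega)))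
      ((projPerp_eq_zero_iff f i _).1 h)
  have h1 := hf.shortest i (by omega) _ (hf.mem _ hi) h0
  have h2 := norm_projPerp_sq_succ f i (f (i + 1))
  rw [← gsVec] at h2
  have h3 := hf.gsCoeff_sq_le hi (Nat.lt_succ_self i)
  have h4 : ‖gsVec f i‖ ^ 2 ≤ ‖projPerp f i (f (i + 1))‖ ^ 2 :=
    pow_le_pow_left₀ (norm_nonneg _) h1 2
  have h5 := mul_le_mul_of_nonneg_right h3 (sq_nonneg ‖gsVec f i‖)
  linarith

theorem IsHKZSystem.norm_gsVec_sq_le (hf : IsHKZSystem L f n) (i d : ℕ) (hi : i + d < n) :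
    ‖gsVec f i‖ ^ 2 ≤ (4 / 3) ^ d * ‖gsVec f (i + d)‖ ^ 2 := by
  induction d with
  | zero => simp
  | succ d ih =>
    have h1 := hf.norm_gsVec_sq_le_succ (i := i + d) (by omega)
    calc _ ≤ (4 / 3) ^ d * ‖gsVec f (i + d)‖ ^ 2 := ih (by omega)
      _ ≤ (4 / 3) ^ d * (4 / 3 * ‖gsVec f (i + d + 1)‖ ^ 2) := by gcongr
      _ = _ := by rw [add_assoc]; ring

/-- Undoing one projection adds at most `1/4 * (4/3) ^ (d + 1)` to the factor `(4/3) ^ d`, and `1 +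
1/4 * 4/3 = 4/3`. -/
theorem IsHKZSystem.norm_projPerp_sq_le (hf : IsHKZSystem L f n) (i d : ℕ) (hi : i + d < n) :
    ‖projPerp f i (f (i + d))‖ ^ 2 ≤ (4 / 3) ^ d * ‖gsVec f (i + d)‖ ^ 2 := by
  induction d generalizing i with
  | zero => simp [gsVec]
  | succ d ih =>
    have h1 := ih (i + 1) (by omega)
    have h2 := hf.norm_gsVec_sq_le i (d + 1) hi
    have h3 := norm_projPerp_sq_succ f i (f (i + (d + 1)))
    have h4 := hf.gsCoeff_sq_le (j := i) hi (by omega)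
    have h5 := mul_le_mul_of_nonneg_right h4 (sq_nonneg ‖gsVec f i‖)
    rw [show i + 1 + d = i + (d + 1) by ring] at h1
    rw [pow_succ (4 / 3 : ℝ)] at h2 ⊢
    linarith

/-- Deliberately lossy: the exponent `d / 2` would suffice, but `d` matches the constants of the
theorem. -/
theorem le_pow_mul_of_sq_le {x y c : ℝ} {d : ℕ} (hy : 0 ≤ y) (hc : 1 ≤ c)
    (h : x ^ 2 ≤ c ^ d * y ^ 2) : x ≤ c ^ d * y := by
  have h1 : 1 ≤ c ^ d := one_le_pow₀ hc
  refine le_of_sq_le_sq ?_ (by positivity)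
  calc x ^ 2 ≤ c ^ d * y ^ 2 := h
    _ ≤ c ^ d * (c ^ d * y ^ 2) :=
      le_mul_of_one_le_left (by positivity) h1 |>.trans_eq (by ring)
    _ = _ := by ring

theorem IsHKZSystem.norm_le (hf : IsHKZSystem L f n) {i : ℕ} (hi : i < n) :
    ‖f i‖ ≤ (4 / 3) ^ i * ‖gsVec f i‖ := by
  have h := hf.norm_projPerp_sq_le 0 i (by omega)
  rw [projPerp_zero, zero_add] at h
  exact le_pow_mul_of_sq_le (norm_nonneg _) (by norm_num) h

theorem IsHKZSystem.norm_zero_le (hf : IsHKZSystem L f n) {i : ℕ} (hi : i < n) :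
    ‖f 0‖ ≤ (4 / 3) ^ i * ‖gsVec f i‖ := by
  have h := hf.norm_gsVec_sq_le 0 i (by omega)
  rw [gsVec, projPerp_zero, zero_add] at h
  exact le_pow_mul_of_sq_le (norm_nonneg _) (by norm_num) h

/-- The factor `j = i` of the product bounds `‖f i‖`, each other one bounds a copy of `‖f 0‖`; the
exponents `0, …, n - 1` add up to `n (n - 1) / 2`. -/
theorem IsHKZSystem.norm_mul_pow_le (hf : IsHKZSystem L f n) {i : ℕ} (hi : i < n) :
    ‖f i‖ * ‖f 0‖ ^ (n - 1) ≤ (4 / 3) ^ (n * (n - 1) / 2) * ∏ j ∈ Finset.range n, ‖gsVec f j‖ := by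
  have hin : i ∈ Finset.range n := Finset.mem_range.2 hi
  rw [← Finset.sum_range_id, ← Finset.prod_pow_eq_pow_sum, ← Finset.prod_mul_distrib,
    ← Finset.mul_prod_erase _ _ hin]
  have h1 : ‖f 0‖ ^ (n - 1) = ∏ _j ∈ (Finset.range n).erase i, ‖f 0‖ := by
    rw [Finset.prod_const, Finset.card_erase_of_mem hin, Finset.card_range]
  rw [h1]
  refine mul_le_mul (hf.norm_le hi) (Finset.prod_le_prod (fun _ _ => norm_nonneg _) fun j hj => ?_)
    (by positivity) (by positivity)
  exact hf.norm_zero_le (Finset.mem_range.1 (Finset.mem_of_mem_erase hj))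

/-- Pairing `b` with the Gram–Schmidt expansion of `f i` shows that each partial sum is at most
`3/2` times the previous one, plus `1` when `i = j`. The sums therefore vanish up to index `j` and
then grow geometrically. -/
theorem IsHKZSystem.sum_abs_inner_dual_le (hf : IsHKZSystem L f n) {b : E} {j : ℕ}
    (hb : ∀ i < n, inner ℝ b (f i) = if i = j then (1 : ℝ) else 0) {i : ℕ} (hi : i ≤ n) :
    ∑ k ∈ Finset.range i, |inner ℝ b (gsVec f k)| ≤ if i ≤ j then 0 else (3 / 2) ^ (i - 1) := by
  induction i with
  | zero => simp
  | succ i ih =>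
    have ih := ih (by omega)
    have h1 : inner ℝ b (gsVec f i) = (if i = j then (1 : ℝ) else 0) -
        ∑ k ∈ Finset.range i, gsCoeff f k (f i) * inner ℝ b (gsVec f k) := by
      have h := congrArg (inner ℝ b) (eq_projPerp_add_sum f (f i) i)
      rw [hb i (by omega), inner_add_right, inner_sum] at h
      simp only [real_inner_smul_right] at h
      rw [h, gsVec]
      ring
    have h2 : |∑ k ∈ Finset.range i, gsCoeff f k (f i) * inner ℝ b (gsVec f k)| ≤
        1 / 2 * ∑ k ∈ Finset.range i, |inner ℝ b (gsVec f k)| := by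
      rw [Finset.mul_sum]
      refine (Finset.abs_sum_le_sum_abs _ _).trans (Finset.sum_le_sum fun k hk => ?_)
      rw [abs_mul]
      gcongr
      exact hf.size_reduced i (by omega) k (Finset.mem_range.1 hk)
    have h3 : |inner ℝ b (gsVec f i)| ≤ (if i = j then (1 : ℝ) else 0) +
        1 / 2 * ∑ k ∈ Finset.range i, |inner ℝ b (gsVec f k)| := by
      rw [h1]
      refine (abs_sub _ _).trans (add_le_add (le_of_eq (abs_of_nonneg ?_)) h2)
      split_ifs <;> norm_num
    rw [Finset.sum_range_succ]
    rcases lt_trichotomy i j with h | rfl | h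
    · rw [if_pos h.le] at ih
      rw [if_neg h.ne] at h3
      rw [if_pos (by omega)]
      linarith
    · rw [if_pos le_rfl] at ih
      rw [if_pos rfl] at h3
      rw [if_neg (by omega), Nat.add_sub_cancel]
      have : (1 : ℝ) ≤ (3 / 2) ^ i := one_le_pow₀ (by norm_num)
      linarith
    · rw [if_neg (by omega)] at ih
      rw [if_neg h.ne'] at h3
      rw [if_neg (by omega), Nat.add_sub_cancel]
      have : ((3 : ℝ) / 2) ^ i = 3 / 2 * (3 / 2) ^ (i - 1) := by
        rw [← pow_succ', Nat.sub_add_cancel (by omega)]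
      linarith

/-- In the orthogonal basis the components of `b` have norm `|⟨b, a*ₖ⟩| / ‖a*ₖ‖`. The numerators
contribute `(3/2) ^ (n - 1)` in total, the ratios `‖f 0‖ / ‖a*ₖ‖` at most `(4/3) ^ (n - 1)`, and
`3/2 * 4/3 = 2`. -/
theorem IsHKZSystem.norm_dual_mul_le (hf : IsHKZSystem L f n)
    (hspan : Submodule.span ℝ (f '' Set.Iio n) = ⊤) {b : E} {j : ℕ}
    (hb : ∀ i < n, inner ℝ b (f i) = if i = j then (1 : ℝ) else 0) :
    ‖b‖ * ‖f 0‖ ≤ 2 ^ (n - 1) := by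
  have h1 : b = ∑ k ∈ Finset.range n, gsCoeff f k b • gsVec f k := by
    conv_lhs => rw [eq_projPerp_add_sum f b n]
    rw [(projPerp_eq_zero_iff f n b).2 (by simp [hspan]), zero_add]
  have h2 : ∀ k ∈ Finset.range n, ‖gsCoeff f k b • gsVec f k‖ * ‖f 0‖ ≤
      |inner ℝ b (gsVec f k)| * (4 / 3) ^ (n - 1) := fun k hk => by
    have hkn := Finset.mem_range.1 hk
    have hpos := hf.norm_gsVec_pos hkn
    have h3 := hf.norm_zero_le hkn
    have h4 : ((4 : ℝ) / 3) ^ k ≤ (4 / 3) ^ (n - 1) :=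
      pow_le_pow_right₀ (by norm_num) (by omega)
    have h5 : ‖gsCoeff f k b • gsVec f k‖ = |inner ℝ b (gsVec f k)| / ‖gsVec f k‖ := by
      rw [norm_smul, Real.norm_eq_abs, gsCoeff, abs_div, 
        abs_of_pos (by positivity : (0 : ℝ) < ‖gsVec f k‖ ^ 2)]
      field_simp
    rw [h5, div_mul_eq_mul_div, div_le_iff₀ hpos, mul_assoc]
    gcongr
    exact h3.trans (by gcongr)
  have h6 := hf.sum_abs_inner_dual_le hb le_rfl
  have h7 : (if n ≤ j then 0 else ((3 : ℝ) / 2) ^ (n - 1)) ≤ (3 / 2) ^ (n - 1) := by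
    split_ifs
    · positivity
    · exact le_rfl
  calc ‖b‖ * ‖f 0‖ ≤ (∑ k ∈ Finset.range n, ‖gsCoeff f k b • gsVec f k‖) * ‖f 0‖ := by
        gcongr
        conv_lhs => rw [h1]
        exact norm_sum_le _ _
    _ ≤ (∑ k ∈ Finset.range n, |inner ℝ b (gsVec f k)|) * (4 / 3) ^ (n - 1) := by
        rw [Finset.sum_mul, Finset.sum_mul]
        exact Finset.sum_le_sum h2
    _ ≤ (3 / 2) ^ (n - 1) * (4 / 3) ^ (n - 1) := by
        gcongr
        exact h6.trans h7
    _ = 2 ^ (n - 1) := by rw [← mul_pow]; norm_num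

theorem three_halves_pow_le (m : ℕ) : ((3 : ℝ) / 2) ^ m ≤ (m + 1 + 2 ^ m) / 2 := by
  induction m with
  | zero => norm_num
  | succ m ih =>
    have h : (m : ℝ) ≤ 2 ^ m := by exact_mod_cast Nat.lt_two_pow_self.le
    rw [pow_succ, pow_succ]
    push_cast
    linarith

/-- Passes from the dual bound `2 ^ (n - 1)` to the weaker constant of the theorem; the square root
is at least `1/2`. -/
theorem two_pow_le_mul_sqrt {n : ℕ} (hn : 1 ≤ n) :
    (2 : ℝ) ^ (n - 1) ≤
      (n + 2 ^ (n - 1)) * √((n : ℝ) / (2 * (n + 1))) * (4 / 3) ^ (n * (n - 1) / 2) := by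
  obtain ⟨m, rfl⟩ : ∃ m, n = m + 1 := ⟨n - 1, by omega⟩
  rw [Nat.add_sub_cancel]
  have h1 : (1 : ℝ) / 2 ≤ √(((m + 1 : ℕ) : ℝ) / (2 * ((m + 1 : ℕ) + 1))) := by
    refine Real.le_sqrt_of_sq_le ?_
    rw [le_div_iff₀ (by positivity)]
    push_cast
    nlinarith [(Nat.cast_nonneg m : (0 : ℝ) ≤ m)]
  have h2 : ((4 : ℝ) / 3) ^ m ≤ (4 / 3) ^ ((m + 1) * m / 2) := by
    refine pow_le_pow_right₀ (by norm_num) ?_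
    rw [Nat.le_div_iff_mul_le two_pos]
    rcases m with _ | m
    · simp
    · nlinarith
  calc (2 : ℝ) ^ m = (3 / 2) ^ m * (4 / 3) ^ m := by rw [← mul_pow]; norm_num
    _ ≤ ((m + 1 + 2 ^ m) / 2) * (4 / 3) ^ ((m + 1) * m / 2) := by
        gcongr
        exact three_halves_pow_le m
    _ = ((m + 1 : ℕ) + 2 ^ m) * (1 / 2) * (4 / 3) ^ ((m + 1) * m / 2) := by push_cast; ring
    _ ≤ _ := by gcongr

end Estimates

/-! ### From prefixes of sequences to lattice bases and the covolume. -/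

section Transfer

variable {E : Type*} [NormedAddCommGroup E] [InnerProductSpace ℝ E] [FiniteDimensional ℝ E]

theorem image_val_comp_Iio {α : Type*} (f : ℕ → α) {n : ℕ} (i : Fin n) :
    (fun k : Fin n => f k) '' Set.Iio i = f '' Set.Iio (i : ℕ) := by
  ext x
  constructor
  · rintro ⟨k, hk, rfl⟩
    exact ⟨k, hk, rfl⟩
  · rintro ⟨k, hk, rfl⟩
    exact ⟨⟨k, lt_trans hk i.2⟩, hk, rfl⟩

theorem gsVec_eq_gramSchmidt (f : ℕ → E) {n : ℕ} (i : Fin n) :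
    gsVec f i = InnerProductSpace.gramSchmidt ℝ (fun k : Fin n => f k) i := by
  have hspan : Submodule.span ℝ (f '' Set.Iio (i : ℕ)) = Submodule.span ℝ
      (InnerProductSpace.gramSchmidt ℝ (fun k : Fin n => f k) '' Set.Iio i) := by
    rw [InnerProductSpace.span_gramSchmidt_Iio, image_val_comp_Iio]
  rw [gsVec, projPerp]
  refine Submodule.eq_starProjection_of_mem_orthogonal
    (K := (Submodule.span ℝ (f '' Set.Iio (i : ℕ)))ᗮ) ?_ ?_
  · rw [hspan, Submodule.mem_orthogonal]
    intro u hu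
    induction hu using Submodule.span_induction with
    | mem x hx =>
      obtain ⟨k, hk, rfl⟩ := hx
      exact InnerProductSpace.gramSchmidt_orthogonal ℝ _ (ne_of_lt hk)
    | zero => simp
    | add x y _ _ hx hy => rw [inner_add_left, hx, hy, add_zero]
    | smul c x _ hx => rw [real_inner_smul_left, hx, mul_zero]
  · rw [Submodule.orthogonal_orthogonal, hspan, InnerProductSpace.gramSchmidt_def, sub_sub_cancel]
    refine Submodule.sum_mem _ fun k hk => ?_
    rw [Submodule.starProjection_singleton]
    exact Submodule.smul_mem _ _ (Submodule.subset_span ⟨k, Finset.mem_Iio.1 hk, rfl⟩)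

/-- In the orthonormalized basis the matrix of the lattice basis is triangular with diagonal entries
`‖gsVec f i‖`. -/
theorem covolume_eq_prod_norm_gsVec [MeasurableSpace E] [BorelSpace E] {L : Submodule ℤ E}
    [DiscreteTopology L] [IsZLattice ℝ L] {f : ℕ → E} {n : ℕ}
    (hfr : Module.finrank ℝ E = n) (h0 : ∀ i < n, gsVec f i ≠ 0) (a : Module.Basis (Fin n) ℤ L)
    (ha : ∀ i, (a i : E) = f i) :
    ZLattice.covolume L = ∏ i ∈ Finset.range n, ‖gsVec f i‖ := by
  have hc : Module.finrank ℝ E = Fintype.card (Fin n) := by simpa using hfr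
  set e := InnerProductSpace.gramSchmidtOrthonormalBasis hc (fun k : Fin n => f k) with he
  have h1 : MeasureTheory.volume.real (ZSpan.fundamentalDomain e.toBasis) = 1 := by
    rw [MeasureTheory.measureReal_congr (ZSpan.fundamentalDomain_ae_parallelepiped _ _)]
    rw [OrthonormalBasis.coe_toBasis, MeasureTheory.measureReal_def, e.volume_parallelepiped]
    simp
  have hfa : ((↑) ∘ a : Fin n → E) = fun k : Fin n => f k := funext ha
  have h2 : ∀ i : Fin n, inner ℝ (e i) (f i) = ‖gsVec f i‖ := fun i => by
    have hpos : ‖gsVec f i‖ ≠ 0 := norm_ne_zero_iff.2 (h0 i i.2)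
    have h3 : InnerProductSpace.gramSchmidtNormed ℝ (fun k : Fin n => f k) i =
        ‖gsVec f i‖⁻¹ • gsVec f i := by
      rw [InnerProductSpace.gramSchmidtNormed, ← gsVec_eq_gramSchmidt]
      rfl
    rw [he, InnerProductSpace.gramSchmidtOrthonormalBasis_apply, h3, real_inner_smul_left,
      real_inner_comm, inner_self_gsVec]
    · field_simp
    · rw [h3]
      exact smul_ne_zero (inv_ne_zero hpos) (h0 i i.2)
  rw [ZLattice.covolume_eq_det_mul_measureReal L MeasureTheory.volume a e.toBasis, h1, mul_one, hfa,
    he, InnerProductSpace.gramSchmidtOrthonormalBasis_det, ← he]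
  simp_rw [h2]
  rw [Finset.prod_range, abs_of_nonneg (by positivity)]

theorem IsHKZSystem.span_eq_top {L : Submodule ℤ E} {f : ℕ → E} {n : ℕ} (hf : IsHKZSystem L f n)
    (hfr : Module.finrank ℝ E = n) : Submodule.span ℝ (f '' Set.Iio n) = ⊤ := by
  refine Submodule.eq_top_of_finrank_eq ?_
  have h : LinearIndependent ℝ fun i : Set.Iio n => f i := hf.linearIndepOn
  have h1 := finrank_span_eq_card h
  rw [Set.image_eq_range, h1, hfr]
  simp

/-- With `n` vectors the real span is everything, so primitivity says that they generate `L`. -/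
theorem IsHKZSystem.exists_basis {L : Submodule ℤ E} {f : ℕ → E} {n : ℕ} (hf : IsHKZSystem L f n)
    (hfr : Module.finrank ℝ E = n) :
    ∃ a : Module.Basis (Fin n) ℤ L, ∀ i, (a i : E) = f i := by
  have himg : Set.range (fun i : Fin n => f i) = f '' Set.Iio n := by
    ext x
    constructor
    · rintro ⟨k, rfl⟩
      exact ⟨k, k.2, rfl⟩
    · rintro ⟨k, hk, rfl⟩
      exact ⟨⟨k, hk⟩, rfl⟩
  set v : Fin n → L := fun i => ⟨f i, hf.mem i i.2⟩ with hv
  have hli : LinearIndependent ℤ v := by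
    have h1 : LinearIndependent ℝ (fun i : Fin n => f i) :=
      LinearIndependent.comp (v := fun i : Set.Iio n => f i) hf.linearIndepOn
        (fun i : Fin n => ⟨i, i.2⟩) fun i j h => Fin.ext (congrArg Subtype.val h)
    have h2 : LinearIndependent ℤ (fun i : Fin n => f i) :=
      h1.restrict_scalars (by
        intro x y h
        simpa using h)
    exact LinearIndependent.of_comp L.subtype h2
  have hsp : ⊤ ≤ Submodule.span ℤ (Set.range v) := by
    rintro ⟨x, hx⟩ -
    have h1 := hf.primitive x hx (by simp [hf.span_eq_top hfr])
    rw [← himg, show (fun i : Fin n => f i) = L.subtype ∘ v from rfl, Set.range_comp,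
      ← Submodule.map_span] at h1
    obtain ⟨y, hy, hyx⟩ := h1
    rwa [← Subtype.ext (a1 := y) (a2 := ⟨x, hx⟩) hyx]
  exact ⟨Module.Basis.mk hli hsp, fun i => by rw [Module.Basis.mk_apply]⟩

end Transfer

/-! ### Smooth bodies inside a convex hull are illuminated. -/

section Illumination

variable {n : ℕ} {K : Set (EuclideanSpace ℝ (Fin n))}

theorem IsSupportHyperplane.vadd {y : EuclideanSpace ℝ (Fin n)} {H : Set (EuclideanSpace ℝ (Fin n))}
    (h : IsSupportHyperplane K y H) (v : EuclideanSpace ℝ (Fin n)) :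
    IsSupportHyperplane (v +ᵥ K) (v +ᵥ y) (v +ᵥ H) := by
  obtain ⟨u, hu, rfl, hK⟩ := h
  refine ⟨u, hu, ?_, ?_⟩
  · ext x
    rw [Set.mem_vadd_set_iff_neg_vadd_mem]
    simp only [Set.mem_ofPred_eq, vadd_eq_add, inner_add_right, inner_neg_right]
    constructor <;> intro h <;> linarith
  · rintro _ ⟨x, hx, rfl⟩
    simpa only [vadd_eq_add, inner_add_right, add_le_add_iff_left] using hK x hx

theorem IsSmoothConvexBody.vadd (hK : IsSmoothConvexBody K) (v : EuclideanSpace ℝ (Fin n)) :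
    IsSmoothConvexBody (v +ᵥ K) := by
  have himg : v +ᵥ K = Homeomorph.addLeft v '' K := rfl
  refine ⟨hK.convex.vadd v, hK.isCompact.vadd v, ?_, fun y hy => ?_⟩
  · rw [himg, ← Homeomorph.image_interior]
    exact hK.interior_nonempty.image _
  · rw [himg, ← Homeomorph.image_frontier] at hy
    obtain ⟨y, hy, rfl⟩ := hy
    obtain ⟨H, hH, huniq⟩ := hK.smooth y hy
    refine ⟨v +ᵥ H, hH.vadd v, fun H' hH' => ?_⟩
    have h := IsSupportHyperplane.vadd hH' (-v)
    have hyv : -v +ᵥ (Homeomorph.addLeft v) y = y := neg_vadd_vadd v y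
    rw [neg_vadd_vadd, hyv] at h
    rw [← huniq _ h, vadd_neg_vadd]

theorem inner_lt_of_mem_interior {u z : EuclideanSpace ℝ (Fin n)} {c : ℝ} (hu : u ≠ 0)
    (hK : ∀ x ∈ K, inner ℝ u x ≤ c) (hz : z ∈ interior K) : inner ℝ u z < c := by
  have hcont : ContinuousAt (fun ε : ℝ => z + ε • u) 0 := by fun_prop
  -- A small move from `z` along `u` stays in `K` and strictly increases the pairing with `u`.
  have hev : ∀ᶠ ε : ℝ in nhds 0, z + ε • u ∈ K :=
    hcont.eventually_mem (by simpa using mem_interior_iff_mem_nhds.1 hz)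
  obtain ⟨ε, hε, hε0⟩ := ((hev.filter_mono nhdsWithin_le_nhds).and
    (self_mem_nhdsWithin (s := Set.Ioi (0 : ℝ)))).exists
  have h := hK _ hε
  rw [inner_add_right, real_inner_smul_right, real_inner_self_eq_norm_sq] at h
  have h1 : 0 < ε * ‖u‖ ^ 2 := mul_pos hε0 (by positivity)
  linarith

/-- If a smooth convex body lies in the interior of the convex hull of `S`, then `S`
illuminates it. -/
theorem IsSmoothConvexBody.illuminates (hK : IsSmoothConvexBody K)
    {S : Set (EuclideanSpace ℝ (Fin n))} (hS : K ⊆ interior (convexHull ℝ S)) :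
    Illuminates S K := by
  intro y hy
  have hyK : y ∈ K := hK.isCompact.isClosed.frontier_subset hy
  obtain ⟨H, hH, huniq⟩ := hK.smooth y hy
  obtain ⟨u, hu, rfl, hsup⟩ := hH
  -- Otherwise the hull lies in the supporting half-space at `y`, although `y` is interior to the
  -- hull.
  obtain ⟨x, hxS, hx⟩ : ∃ x ∈ S, inner ℝ u y < inner ℝ u x := by
    by_contra! h
    have hsub : convexHull ℝ S ⊆ {x | inner ℝ u x ≤ inner ℝ u y} :=
      convexHull_min h (convex_halfSpace_le
        ⟨fun _ _ => inner_add_right _ _ _, fun _ _ => real_inner_smul_right _ _ _⟩ _)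
    exact (inner_lt_of_mem_interior hu hsub (hS hyK)).false
  refine ⟨x, hxS, ?_, ?_⟩
  · rw [Set.disjoint_left]
    rintro _ ⟨a, b, ha, hb, hab, rfl⟩ hz
    have h := inner_lt_of_mem_interior hu hsup hz
    rw [inner_add_right, real_inner_smul_right, real_inner_smul_right] at h
    have h1 : inner ℝ u y = a * inner ℝ u y + b * inner ℝ u y := by rw [← add_mul, hab, one_mul]
    nlinarith [mul_le_mul_of_nonneg_left hx.le ha]
  · by_contra hne
    rw [Set.not_nonempty_iff_eq_empty, ← Set.disjoint_iff_inter_eq_empty] at hne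
    obtain ⟨f, c, hf1, hf2⟩ := geometric_hahn_banach_open hK.convex.interior isOpen_interior
      (AffineSubspace.convex (line[ℝ, x, y])) hne.symm
    have hline : ∀ s : ℝ, c ≤ f y + s * (f x - f y) := fun s => by
      have h := hf2 _ (AffineMap.lineMap_mem_affineSpan_pair s y x |> fun h => by
        rwa [Set.pair_comm] at h)
      rw [AffineMap.lineMap_apply_module'] at h
      simp only [map_add, map_smul, map_sub, smul_eq_mul] at h
      linarith
    -- An affine function bounded below on a whole line is constant there, so the separating
    -- functional gives a support hyperplane at `y` containing `x`.
    have hxy : f x = f y := by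
      by_contra h0
      have h1 := hline ((c - f y - 1) / (f x - f y))
      rw [div_mul_cancel₀ _ (sub_ne_zero.2 h0)] at h1
      linarith
    have hcy : c ≤ f y := by simpa using hline 0
    set w := (InnerProductSpace.toDual ℝ (EuclideanSpace ℝ (Fin n))).symm f with hw
    have hwf : ∀ z, inner ℝ w z = f z := fun z => InnerProductSpace.toDual_symm_apply
    obtain ⟨z, hz⟩ := hK.interior_nonempty
    have hw0 : w ≠ 0 := by
      intro h0
      have h1 := hf1 z hz
      rw [← hwf] at h1 hcy
      rw [h0, inner_zero_left] at h1 hcy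
      linarith
    have hsupw : ∀ p ∈ K, inner ℝ w p ≤ inner ℝ w y := by
      have hcl : K ⊆ closure (interior K) :=
        (hK.convex.closure_interior_eq_closure_of_nonempty_interior ⟨z, hz⟩).symm ▸ subset_closure
      intro p hp
      rw [hwf, hwf]
      exact closure_minimal (fun q hq => ((hf1 q hq).le.trans hcy : f q ≤ f y))
        (isClosed_le f.continuous continuous_const) (hcl hp)
    have heq := huniq _ ⟨w, hw0, rfl, hsupw⟩
    have hxmem : x ∈ {x | inner ℝ w x = inner ℝ w y} := by
      rw [Set.mem_ofPred_eq, hwf, hwf, hxy]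
    rw [heq] at hxmem
    exact hx.ne' hxmem

end Illumination

/-! ### Fitting a body into a simplex. -/

section Simplex

variable {n : ℕ}

theorem mem_convexHull_zero_smul_basis {E : Type*} [AddCommGroup E] [Module ℝ E]
    (B : Module.Basis (Fin n) ℝ E) {t : ℝ} (ht : 0 < t) {x : E} (h0 : ∀ i, 0 ≤ B.repr x i)
    (hsum : ∑ i, B.repr x i ≤ t) :
    x ∈ convexHull ℝ (insert 0 (Set.range fun i => t • B i)) := by
  -- `none` stands for the vertex `0`, which takes the leftover weight.
  set w : Option (Fin n) → ℝ := fun o => o.elim (1 - ∑ i, B.repr x i / t) fun i => B.repr x i / t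
  set z : Option (Fin n) → E := fun o => o.elim 0 fun i => t • B i
  have hx : x = ∑ o, w o • z o := by
    simp only [w, z, Fintype.sum_option, Option.elim_none, Option.elim_some, smul_zero, zero_add,
      smul_smul, div_mul_cancel₀ _ ht.ne']
    exact (B.sum_repr x).symm
  rw [hx]
  refine (convex_convexHull ℝ _).sum_mem (fun o _ => ?_) ?_ fun o _ => subset_convexHull ℝ _ ?_
  · rcases o with _ | i
    · simp only [w, Option.elim_none]
      rw [← Finset.sum_div, sub_nonneg, div_le_one ht]
      exact hsum
    · exact div_nonneg (h0 i) ht.le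
  · simp [w, Fintype.sum_option]
  · rcases o with _ | i
    · exact Set.mem_insert _ _
    · exact Set.mem_insert_of_mem _ ⟨i, rfl⟩

/-- A compact set of diameter `D` has a translate in the interior of the simplex with vertices `0`
and `t • B i`, provided `t` exceeds `D` times the sum of the norms of the dual basis vectors. -/
theorem exists_vadd_subset_interior_convexHull {E : Type*} [NormedAddCommGroup E]
    [InnerProductSpace ℝ E] {K : Set E} (hK : IsCompact K) (hne : K.Nonempty)
    (B : Module.Basis (Fin n) ℝ E) (b : Fin n → E) (hb : ∀ i x, inner ℝ (b i) x = B.repr x i)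
    {t : ℝ} (ht : Metric.diam K * ∑ i, ‖b i‖ < t) :
    ∃ v : E, v +ᵥ K ⊆ interior (convexHull ℝ (insert 0 (Set.range fun i => t • B i))) := by
  have hcont : ∀ i, Continuous fun x : E => inner ℝ (b i) x := fun i => by fun_prop
  choose p hpK hp using fun i => hK.exists_isMinOn hne (hcont i).continuousOn
  have ht0 : 0 < t := lt_of_le_of_lt
    (mul_nonneg Metric.diam_nonneg (Finset.sum_nonneg fun _ _ => norm_nonneg _)) ht
  -- The slack is cut into `n + 1` parts: `n` of them keep the coordinates positive, the last keeps
  -- their sum below `t`.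
  set ε := (t - Metric.diam K * ∑ i, ‖b i‖) / (n + 1) with hε
  have hε0 : 0 < ε := div_pos (sub_pos.2 ht) (by positivity)
  have hnε : n * ε < t - Metric.diam K * ∑ i, ‖b i‖ := by
    have : ε * (n + 1) = t - Metric.diam K * ∑ i, ‖b i‖ := div_mul_cancel₀ _ (by positivity)
    linarith
  -- With this translation the minimum of each dual coordinate over the body is exactly `ε`.
  refine ⟨∑ i, (ε - inner ℝ (b i) (p i)) • B i, ?_⟩
  set v := ∑ i, (ε - inner ℝ (b i) (p i)) • B i with hv
  have hbv : ∀ i, inner ℝ (b i) v = ε - inner ℝ (b i) (p i) := fun i => by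
    rw [hb, hv, B.repr_sum_self]
  set U : Set E := {x | (∀ i, 0 < inner ℝ (b i) x) ∧ ∑ i, inner ℝ (b i) x < t} with hU
  have hUo : IsOpen U := by
    have h : IsOpen {x : E | ∀ i, 0 < inner ℝ (b i) x} := by
      rw [Set.ofPred_forall]
      exact isOpen_iInter_of_finite fun i => isOpen_lt continuous_const (hcont i)
    exact h.inter (isOpen_lt (continuous_finsetSum _ fun i _ => hcont i) continuous_const)
  have hUsub : U ⊆ convexHull ℝ (insert 0 (Set.range fun i => t • B i)) := fun x hx => by
    simp only [hU, hb, Set.mem_ofPred_eq] at hx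
    exact mem_convexHull_zero_smul_basis B ht0 (fun i => (hx.1 i).le) hx.2.le
  refine Set.Subset.trans ?_ (interior_maximal hUsub hUo)
  rintro _ ⟨y, hy, rfl⟩
  have hin : ∀ i, inner ℝ (b i) (v +ᵥ y) = ε + inner ℝ (b i) (y - p i) := fun i => by
    rw [vadd_eq_add, inner_add_right, hbv, inner_sub_right]
    ring
  have hup : ∀ i, inner ℝ (b i) (y - p i) ≤ Metric.diam K * ‖b i‖ := fun i => by
    refine (real_inner_le_norm _ _).trans ?_
    rw [mul_comm, ← dist_eq_norm]
    gcongr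
    exact Metric.dist_le_diam_of_mem hK.isBounded hy (hpK i)
  refine ⟨fun i => ?_, ?_⟩
  · show 0 < inner ℝ (b i) (v +ᵥ y)
    have h : inner ℝ (b i) (p i) ≤ inner ℝ (b i) y := hp i hy
    rw [hin, inner_sub_right]
    linarith
  · show ∑ i, inner ℝ (b i) (v +ᵥ y) < t
    simp only [hin]
    rw [Finset.sum_add_distrib, Finset.sum_const, Finset.card_univ, Fintype.card_fin, nsmul_eq_mul]
    have h := Finset.sum_le_sum fun i (_ : i ∈ Finset.univ) => hup i
    rw [← Finset.mul_sum] at h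
    linarith

theorem illuminationDist_le {S T : Set (EuclideanSpace ℝ (Fin n))} {R : ℝ} (hR : 0 ≤ R)
    (hS : ∀ x ∈ S, ‖x‖ ≤ R) (hT : T ⊆ convexHull ℝ S) : illuminationDist S T ≤ 2 * R := by
  refine Real.sSup_le ?_ (by positivity)
  rintro _ ⟨x, hx, y, hy, rfl⟩
  have hy' : y ∈ Metric.closedBall (0 : EuclideanSpace ℝ (Fin n)) R :=
    convexHull_min (fun z hz => mem_closedBall_zero_iff.2 (hS z hz)) (convex_closedBall _ _) (hT hy)
  rw [dist_eq_norm]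
  have := norm_sub_le x y
  have := hS x hx
  have := mem_closedBall_zero_iff.1 hy'
  linarith

end Simplex

/-! ### Reduced systems in the stated definitions, and the main theorem. -/

section Lattice

variable {n : ℕ} {L : Submodule ℤ (EuclideanSpace ℝ (Fin n))} {f : ℕ → EuclideanSpace ℝ (Fin n)}

theorem IsHKZSystem.isHKZReduced (hf : IsHKZSystem L f n) (a : Module.Basis (Fin n) ℤ L)
    (ha : ∀ i, (a i : EuclideanSpace ℝ (Fin n)) = f i) : IsHKZReduced a := by
  have hfa : (fun k => (a k : EuclideanSpace ℝ (Fin n))) = fun k : Fin n => f k := funext ha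
  refine ⟨fun i j hij => ?_, fun i x hx => ?_⟩
  · rw [hfa, ha, ← gsVec_eq_gramSchmidt]
    exact hf.size_reduced i i.2 j hij
  · rw [hfa, ← gsVec_eq_gramSchmidt]
    simp only [image_val_comp_Iio]
    exact hf.shortest i i.2 x hx

theorem IsHKZSystem.latticeMinNorm_eq (hf : IsHKZSystem L f n) (hn : 0 < n) :
    latticeMinNorm L = ‖f 0‖ := by
  have hg : gsVec f 0 = f 0 := projPerp_zero f _
  refine IsLeast.csInf_eq ⟨⟨f 0, hf.mem 0 hn, hg ▸ hf.gsVec_ne_zero 0 hn, rfl⟩, ?_⟩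
  rintro _ ⟨x, hx, hx0, rfl⟩
  have h := hf.shortest 0 hn x hx
  rw [projPerp_zero, hg] at h
  exact h hx0

end Lattice

theorem theorem1p2 (n : ℕ) (hn : 1 ≤ n)
    (K : Set (EuclideanSpace ℝ (Fin n))) (hK : IsSmoothConvexBody K)
    (L : Submodule ℤ (EuclideanSpace ℝ (Fin n))) [DiscreteTopology L] [IsZLattice ℝ L] :
    ∃ (a : Module.Basis (Fin n) ℤ L) (t : ℕ) (v : EuclideanSpace ℝ (Fin n))
      (S : Finset (EuclideanSpace ℝ (Fin n))),
      IsHKZReduced a ∧ 1 ≤ t ∧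
      (S : Set (EuclideanSpace ℝ (Fin n))) =
        insert 0 (Set.range fun i => (t : ℝ) • (a i : EuclideanSpace ℝ (Fin n))) ∧
      (S : Set (EuclideanSpace ℝ (Fin n))) ⊆ L ∧
      S.card = n + 1 ∧
      v +ᵥ K ⊆ interior (convexHull ℝ (S : Set (EuclideanSpace ℝ (Fin n)))) ∧
      Illuminates (S : Set (EuclideanSpace ℝ (Fin n))) (v +ᵥ K) ∧
      illuminationDist (S : Set (EuclideanSpace ℝ (Fin n))) (v +ᵥ K) ≤
        2 * (⌊(n : ℝ) * (n + 2 ^ (n - 1)) * √((n : ℝ) / (2 * (n + 1))) *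
              (4 / 3) ^ (n * (n - 1) / 2) * Metric.diam K / latticeMinNorm L + 1⌋ : ℝ) *
          (4 / 3) ^ (n * (n - 1) / 2) * (ZLattice.covolume L / latticeMinNorm L ^ (n - 1)) ∧
      (latticeMinNorm L ≤
          (n : ℝ) * (n + 2 ^ (n - 1)) * (√2 - √((n : ℝ) / (2 * (n + 1)))) *
            (4 / 3) ^ (n * (n - 1) / 2) * Metric.diam K →
        illuminationDist (S : Set (EuclideanSpace ℝ (Fin n))) (v +ᵥ K) ≤
          2 * √2 * n * (n + 2 ^ (n - 1)) * (4 / 3) ^ (n * (n - 1)) * Metric.diam K *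
            (ZLattice.covolume L / latticeMinNorm L ^ n)) := by
  classical
  have hfr : Module.finrank ℝ (EuclideanSpace ℝ (Fin n)) = n := finrank_euclideanSpace_fin
  obtain ⟨f, hf⟩ := exists_isHKZSystem L hfr.ge
  obtain ⟨a, ha⟩ := hf.exists_basis hfr
  have hlf := hf.latticeMinNorm_eq hn
  have hcov := covolume_eq_prod_norm_gsVec hfr hf.gsVec_ne_zero a ha
  set l := latticeMinNorm L with hl
  have hl0 : 0 < l := by
    rw [hlf, show f 0 = gsVec f 0 from (projPerp_zero f _).symm]
    exact hf.norm_gsVec_pos hn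
  set q : ℝ := (4 / 3) ^ (n * (n - 1) / 2) with hq
  have hq0 : 0 < q := by positivity
  have hqq : ((4 : ℝ) / 3) ^ (n * (n - 1)) = q * q := by
    rw [hq, ← pow_add, ← two_mul, Nat.mul_div_cancel' (Nat.even_mul_pred_self n).two_dvd]
  set s : ℝ := √((n : ℝ) / (2 * (n + 1))) with hs
  set D := Metric.diam K with hD
  have hD0 : 0 ≤ D := Metric.diam_nonneg
  set X : ℝ := (n : ℝ) * (n + 2 ^ (n - 1)) * s * q * D / l with hX
  have hX0 : 0 ≤ X := by positivity
  -- Taking the integer part of `X + 1` rather than of `X` makes `t` positive and gives the strict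
  -- inequality `X < t`.
  have hfloor : 1 ≤ ⌊X + 1⌋ := Int.le_floor.2 (by push_cast; linarith)
  obtain ⟨t, ht⟩ : ∃ t : ℕ, (t : ℤ) = ⌊X + 1⌋ := ⟨⌊X + 1⌋.toNat, Int.toNat_of_nonneg (by omega)⟩
  have htR : (t : ℝ) = (⌊X + 1⌋ : ℝ) := by exact_mod_cast congrArg (Int.cast (R := ℝ)) ht
  have ht1 : 1 ≤ t := by omega
  have ht0 : (t : ℝ) ≠ 0 := by positivity
  have hXt : X < t := by
    have := Int.lt_floor_add_one (X + 1)
    linarith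
  set B := a.ofZLatticeBasis ℝ L with hB
  have hBa : ∀ i, B i = (a i : EuclideanSpace ℝ (Fin n)) := a.ofZLatticeBasis_apply ℝ L
  -- The dual basis: Riesz representatives of the coordinate functionals.
  set b : Fin n → EuclideanSpace ℝ (Fin n) := fun i =>
    (InnerProductSpace.toDual ℝ _).symm (LinearMap.toContinuousLinearMap (B.coord i)) with hb
  have hbB : ∀ i x, inner ℝ (b i) x = B.repr x i := fun i x => InnerProductSpace.toDual_symm_apply
  have hbl : ∀ i, ‖b i‖ ≤ (n + 2 ^ (n - 1)) * s * q / l := fun i => by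
    rw [le_div_iff₀ hl0, hlf]
    refine (hf.norm_dual_mul_le (hf.span_eq_top hfr) (j := i) fun k hk => ?_).trans
      (two_pow_le_mul_sqrt hn)
    rw [hbB, ← ha ⟨k, hk⟩, ← hBa, B.repr_self, Finsupp.single_apply]
    simp [Fin.ext_iff]
  have hDt : D * ∑ i, ‖b i‖ < t := by
    refine lt_of_le_of_lt ?_ hXt
    calc D * ∑ i, ‖b i‖ ≤ D * ∑ _i : Fin n, (n + 2 ^ (n - 1)) * s * q / l := by
          gcongr with i
          exact hbl i
      _ = X := by
          rw [Finset.sum_const, Finset.card_univ, Fintype.card_fin, nsmul_eq_mul, hX]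
          ring
  obtain ⟨v, hv⟩ := exists_vadd_subset_interior_convexHull hK.isCompact
    (hK.interior_nonempty.mono interior_subset) B b hbB hDt
  simp only [hBa] at hv
  set S : Finset (EuclideanSpace ℝ (Fin n)) :=
    insert 0 (Finset.univ.image fun i => (t : ℝ) • (a i : EuclideanSpace ℝ (Fin n))) with hS
  have hSset : (S : Set (EuclideanSpace ℝ (Fin n))) =
      insert 0 (Set.range fun i => (t : ℝ) • (a i : EuclideanSpace ℝ (Fin n))) := by
    simp [hS]
  rw [← hSset] at hv
  have hR : ∀ i, ‖(a i : EuclideanSpace ℝ (Fin n))‖ ≤ q * (ZLattice.covolume L / l ^ (n - 1)) :=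
    fun i => by
      rw [ha, ← mul_div_assoc, le_div_iff₀ (by positivity), hcov, hlf]
      exact hf.norm_mul_pow_le i.2
  have hcov0 : 0 ≤ ZLattice.covolume L := (ZLattice.covolume_pos L MeasureTheory.volume).le
  have hdist : illuminationDist (S : Set (EuclideanSpace ℝ (Fin n))) (v +ᵥ K) ≤
      2 * (t * (q * (ZLattice.covolume L / l ^ (n - 1)))) := by
    refine illuminationDist_le (by positivity) ?_ (hv.trans interior_subset)
    rw [hSset]
    rintro x (rfl | ⟨i, rfl⟩)
    · rw [norm_zero]
      positivity
    · simp only [norm_smul, Real.norm_natCast]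
      gcongr
      exact hR i
  refine ⟨a, t, v, S, hf.isHKZReduced a ha, ht1, hSset, ?_, ?_, hv, (hK.vadd v).illuminates hv,
    ?_, fun hle => ?_⟩
  · rw [hSset]
    rintro x (rfl | ⟨i, rfl⟩)
    · exact L.zero_mem
    · simp only [Nat.cast_smul_eq_nsmul]
      exact nsmul_mem (a i).2 t
  · rw [hS, Finset.card_insert_of_notMem, Finset.card_image_of_injective, Finset.card_univ,
      Fintype.card_fin]
    · intro i j hij
      simp only [← hBa] at hij
      exact B.injective (smul_right_injective _ ht0 hij)
    · simp only [Finset.mem_image, Finset.mem_univ, true_and, not_exists, ← hBa]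
      exact fun i => smul_ne_zero ht0 (B.ne_zero i)
  · rw [← htR]
    exact hdist.trans_eq (by ring)
  · have h1 : (t : ℝ) ≤ X + 1 := htR.trans_le (Int.floor_le _)
    -- Divided by `l`, the extra hypothesis says that the `1` is at most the cost of replacing `s`
    -- by `√2` in `X`.
    have h2 : X + 1 ≤ n * (n + 2 ^ (n - 1)) * √2 * q * D / l := by
      rw [hX, div_add_one hl0.ne']
      gcongr
      linarith
    calc _ ≤ 2 * (t * (q * (ZLattice.covolume L / l ^ (n - 1)))) := hdist
      _ ≤ 2 * (n * (n + 2 ^ (n - 1)) * √2 * q * D / l *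
          (q * (ZLattice.covolume L / l ^ (n - 1)))) := by
        gcongr
        exact h1.trans h2
      _ = _ := by
        rw [hqq, show l ^ n = l ^ (n - 1) * l by rw [← pow_succ, Nat.sub_add_cancel hn]]
        field_simp
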